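/- Let $A=(A_{i,j})_{i,j\in\{1,\dots,c\}}$ be a (deterministic or random) real $c\times c$ matrix with integrable entries, the navigation matrix, and let $X(0)\in\mathbb{R}^c$ be a deterministic starting position. Let $X(t)=(X_1(t),\dots,X_c(t))^T$, $t\ge 0$, be the continuum Pólya-like random walk with these data, i.e., the pure-jump process that evolves as follows. When the walk is at $x$, the waiting time until the next renewal is, given the past, exponentially distributed with rate $\sum_{j}x_j$, and the renewal is, independently of that waiting time, of color $i$ with probability $x_i/\sum_j x_j$. If it is of color $i$, then the $i$th row of a copy of $A$ (which is independent of the past, of the waiting time and of the color) is added to the position. Between renewals the position does not change. Assume that the walk is tenable: almost surely, all coordinates stay nonnegative and the walk never visits the origin. Then for every $t\ge 0$ the random vector $X(t)$ is integrable and $$\mathbb{E}[X(t)] = e^{\mathbb{E}[A^T]\,t}\,X(0),$$ where $e^{M}=\sum_{n\ge 0}M^n/n!$ and $\mathbb{E}[A^T]$ is the entrywise expectation of the transpose of $A$. -/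

import Mathlib

open MeasureTheory ProbabilityTheory

namespace PolyaWalk

variable {Ω Ω' : Type*} {c : ℕ}

/-- Matrices carry the product (entrywise Borel) σ-algebra. -/
instance instMeasurableSpaceMatrix : MeasurableSpace (Matrix (Fin c) (Fin c) ℝ) :=
  inferInstanceAs (MeasurableSpace (Fin c → Fin c → ℝ))

/-- Position of the walk after `n` renewals, started at `x₀`: the `k`-th renewal
(`k = 0, 1, …`) has color `I k`, and it adds the row of color `I k` of the navigation
matrix `M k` used at that renewal. -/
def position (x₀ : Fin c → ℝ) (I : ℕ → Ω → Fin c) (M : ℕ → Ω → Matrix (Fin c) (Fin c) ℝ) :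
    ℕ → Ω → Fin c → ℝ
  | 0, _ => x₀
  | n + 1, ω => position x₀ I M n ω + M n ω (I n ω)

/-- Time of the `n`-th renewal (time `0` for `n = 0`), where `τ k` is the `k`-th waiting time. -/
def renewalTime (τ : ℕ → Ω → ℝ) (n : ℕ) (ω : Ω) : ℝ :=
  ∑ k ∈ Finset.range n, τ k ω

/-- The σ-algebra generated by the first `n` waiting times, colors and navigation matrices. -/
abbrev history (τ : ℕ → Ω → ℝ) (I : ℕ → Ω → Fin c) (M : ℕ → Ω → Matrix (Fin c) (Fin c) ℝ)
    (n : ℕ) : MeasurableSpace Ω :=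
  ⨆ k ∈ Finset.range n,
    MeasurableSpace.comap (τ k) inferInstance ⊔ MeasurableSpace.comap (I k) inferInstance ⊔
      MeasurableSpace.comap (M k) inferInstance

/-- `X` is the walk on the probability space `(Ω, P)` started at `x₀` that is driven by the
waiting times `τ`, the renewal colors `I` and the matrices `M`, where the navigation matrix is
the random matrix `A` on `(Ω', P')`. -/
structure IsDrivenBy [MeasurableSpace Ω] [MeasurableSpace Ω'] (P : Measure Ω) (P' : Measure Ω')
    (A : Ω' → Matrix (Fin c) (Fin c) ℝ) (x₀ : Fin c → ℝ) (X : ℝ → Ω → Fin c → ℝ)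
    (τ : ℕ → Ω → ℝ) (I : ℕ → Ω → Fin c) (M : ℕ → Ω → Matrix (Fin c) (Fin c) ℝ) : Prop where
  measurable_wait : ∀ n, Measurable (τ n)
  measurable_color : ∀ n, Measurable (I n)
  measurable_matrix : ∀ n, Measurable (M n)
  /-- Tenability: the coordinates stay nonnegative and the walk avoids the origin. -/
  tenable : ∀ᵐ ω ∂P, ∀ n, (∀ j, 0 ≤ position x₀ I M n ω j) ∧ position x₀ I M n ω ≠ 0
  /-- Given the past, with current position `x`, the waiting time is exponential with rate
  `∑ j, x j`, and, independently of it, the color is `i` with probability `x i / ∑ j, x j`. -/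
  cond_law : ∀ (n : ℕ) (s : ℝ) (i : Fin c), 0 ≤ s →
    P⟦{ω | s < τ n ω ∧ I n ω = i} | history τ I M n⟧ =ᵐ[P] fun ω =>
      Real.exp (-(s * ∑ j, position x₀ I M n ω j)) *
        (position x₀ I M n ω i / ∑ j, position x₀ I M n ω j)
  /-- The matrix used at each renewal is a copy of the navigation matrix … -/
  identDistrib : ∀ n, IdentDistrib (M n) A P P'
  /-- … and independent of the past, of the waiting time and of the color of the renewal. -/
  indep : ∀ n, Indep (MeasurableSpace.comap (M n) inferInstance)
    (history τ I M n ⊔ MeasurableSpace.comap (τ n) inferInstance ⊔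
      MeasurableSpace.comap (I n) inferInstance) P
  /-- Between two consecutive renewals the walk rests. -/
  path : ∀ᵐ ω ∂P, ∀ (n : ℕ) (t : ℝ), renewalTime τ n ω ≤ t → t < renewalTime τ (n + 1) ω →
    X t ω = position x₀ I M n ω

/-- `X` is a (tenable) continuum Pólya-like random walk on `(Ω, P)` with starting position `x₀`
and with the (possibly random) navigation matrix `A`, given as a random variable on `(Ω', P')`. -/
def IsContinuumPolyaWalk [MeasurableSpace Ω] [MeasurableSpace Ω'] (P : Measure Ω)
    (P' : Measure Ω') (A : Ω' → Matrix (Fin c) (Fin c) ℝ) (x₀ : Fin c → ℝ)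
    (X : ℝ → Ω → Fin c → ℝ) : Prop :=
  ∃ (τ : ℕ → Ω → ℝ) (I : ℕ → Ω → Fin c) (M : ℕ → Ω → Matrix (Fin c) (Fin c) ℝ),
    IsDrivenBy P P' A x₀ X τ I M

/-- The entrywise expectation of the random matrix `B`. -/
noncomputable def meanMatrix [MeasurableSpace Ω'] (P' : Measure Ω')
    (B : Ω' → Matrix (Fin c) (Fin c) ℝ) : Matrix (Fin c) (Fin c) ℝ :=
  Matrix.of fun i j => ∫ ω, B ω i j ∂P'

end PolyaWalk

/-! While the walk sits at `x`, renewals of color `i` occur with intensity `x i`: the color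
probability cancels the total rate. Hence the expected number of `i`-renewals up to `t` is `∫₀ᵗ
E[X_i(u)] du` (`measure_renewal_color`, summed over `n`). The matrix used at a renewal is
independent of that renewal's time and color, so each `i`-renewal adds `E[A i j]` to coordinate `j`
on average (`integral_step`). Together these give the linear integral equation `E[X(t)] = x₀ + E[Aᵀ]
∫₀ᵗ E[X(u)] du` (`integral_coord_eq_add_integral`), whose only bounded solution is the matrix
exponential (`eq_exp_mulVec_of_integral_eq`).

Finiteness must come first. All masses are therefore kept in `ENNReal` and split by the number `n`
of past renewals (`sojournMean`). Restricted to `n < N`, the same argument with `|A i j|` gives an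
integral inequality, and Grönwall bounds the mass uniformly in `N` (`exists_sum_sojournMean_le`).
Letting `N → ∞` makes the expected number of renewals finite, so by Borel–Cantelli the walk does not
explode and `X t` is determined almost surely by its sojourns. -/

namespace PolyaWalk

/-! ### Joint law of the past and an exponential clock -/

theorem lintegral_exp_decay_Ioi {a b : ℝ} (ha : 0 < a) (hb : 0 ≤ b) (s : ℝ) :
    ∫⁻ r in Set.Ioi s, ENNReal.ofReal (b * Real.exp (-(r * a))) =
      ENNReal.ofReal (Real.exp (-(s * a)) * (b / a)) := by
  have hint : IntegrableOn (fun r : ℝ => b * Real.exp (-(r * a))) (Set.Ioi s) := by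
    have := (integrableOn_exp_mul_Ioi (neg_lt_zero.2 ha) s).const_mul b
    refine this.congr (Filter.Eventually.of_forall fun r => ?_)
    simp only
    congr 2
    ring
  rw [← ofReal_integral_eq_lintegral_ofReal hint
    (Filter.Eventually.of_forall fun r => by positivity)]
  congr 1
  rw [integral_const_mul]
  have := integral_exp_mul_Ioi (neg_lt_zero.2 ha) s
  have h2 : ∫ r in Set.Ioi s, Real.exp (-(r * a)) = ∫ r in Set.Ioi s, Real.exp (-a * r) := by
    congr 1; ext r; congr 1; ring
  rw [h2, this, show -a * s = -(s * a) by ring]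
  field_simp

/-- If, given `m`, the time `τ` has exponential tails of rate `a (Z ω)` on the event `E`, which has
conditional probability `b (Z ω) / a (Z ω)`, then `(Z, τ)` has the corresponding joint density
on `E`. -/
theorem setLIntegral_eq_of_exponential_tail {Ω β : Type*} {m m0 : MeasurableSpace Ω}
    [MeasurableSpace β] {P : Measure Ω} [IsProbabilityMeasure P] (hm : m ≤ m0)
    {τ : Ω → ℝ} (hτ : Measurable τ) (hpos : ∀ᵐ ω ∂P, 0 < τ ω) {E : Set Ω} (hE : MeasurableSet E)
    {Z : Ω → β} (hZ : Measurable[m] Z) {a b : β → ℝ} (ha : Measurable a) (hb : Measurable b)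
    (hab : ∀ᵐ ω ∂P, 0 < a (Z ω) ∧ 0 ≤ b (Z ω))
    (hlaw : ∀ s : ℝ, 0 ≤ s → P⟦{ω | s < τ ω ∧ ω ∈ E} | m⟧ =ᵐ[P]
      fun ω => Real.exp (-(s * a (Z ω))) * (b (Z ω) / a (Z ω)))
    {g : β × ℝ → ENNReal} (hg : Measurable g) :
    ∫⁻ ω in E, g (Z ω, τ ω) ∂P =
      ∫⁻ ω, ∫⁻ r in Set.Ioi 0,
        ENNReal.ofReal (b (Z ω) * Real.exp (-(r * a (Z ω)))) * g (Z ω, r) ∂volume ∂P := by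
  have hZ0 : Measurable Z := hZ.mono hm le_rfl
  set w : β × ℝ → ENNReal := fun p => ENNReal.ofReal (b p.1 * Real.exp (-(p.2 * a p.1))) with hw
  have hwm : Measurable w := by fun_prop
  set ν₁ : Measure (β × ℝ) := (P.restrict E).map fun ω => (Z ω, τ ω) with hν₁
  set ν₂ : Measure (β × ℝ) :=
    ((P.map Z).prod (volume.restrict (Set.Ioi 0))).withDensity w with hν₂
  have hZτ : Measurable fun ω => (Z ω, τ ω) := hZ0.prodMk hτ
  have hpm : IsProbabilityMeasure (P.map Z) := Measure.isProbabilityMeasure_map hZ0.aemeasurable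
  have hν₂app : ∀ {A : Set β} {U : Set ℝ}, MeasurableSet A → MeasurableSet U →
      ν₂ (A ×ˢ U) = ∫⁻ ω in Z ⁻¹' A, ∫⁻ r in U ∩ Set.Ioi 0, w (Z ω, r) ∂volume ∂P := by
    intro A U hA hU
    rw [hν₂, withDensity_apply _ (hA.prod hU), ← Measure.prod_restrict, lintegral_prod _
      hwm.aemeasurable, setLIntegral_map hA (by fun_prop) hZ0, Measure.restrict_restrict hU]
  have hν₁app : ∀ {A : Set β} {U : Set ℝ}, MeasurableSet A → MeasurableSet U →
      ν₁ (A ×ˢ U) = P (Z ⁻¹' A ∩ (τ ⁻¹' U ∩ E)) := by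
    intro A U hA hU
    rw [hν₁, Measure.map_apply hZτ (hA.prod hU), Measure.restrict_apply (hZτ (hA.prod hU))]
    congr 1
    ext ω
    simp [and_assoc]
  -- Integrating `hlaw` over `Z ∈ A` shows that both measures have the same tails.
  have htail : ∀ {A : Set β}, MeasurableSet A → ∀ s : ℝ, 0 ≤ s →
      ν₁ (A ×ˢ Set.Ioi s) = ν₂ (A ×ˢ Set.Ioi s) := by
    intro A hA s hs
    have hset : MeasurableSet {ω | s < τ ω ∧ ω ∈ E} := (measurableSet_lt measurable_const hτ).inter hE
    have hAm : MeasurableSet[m] (Z ⁻¹' A) := hZ hA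
    rw [hν₁app hA measurableSet_Ioi, hν₂app hA measurableSet_Ioi,
      Set.inter_eq_left.2 (Set.Ioi_subset_Ioi hs)]
    have h1 := setIntegral_condExp (μ := P) hm
      ((integrable_const (1 : ℝ)).indicator hset) hAm
    rw [setIntegral_congr_ae (hm _ hAm) ((hlaw s hs).mono fun ω h _ => h),
      integral_indicator hset, Measure.restrict_restrict hset] at h1
    have hinter : Z ⁻¹' A ∩ (τ ⁻¹' Set.Ioi s ∩ E) = {ω | s < τ ω ∧ ω ∈ E} ∩ Z ⁻¹' A :=
      Set.inter_comm _ _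
    have hint : Integrable (fun ω => Real.exp (-(s * a (Z ω))) * (b (Z ω) / a (Z ω))) P :=
      (integrable_congr (hlaw s hs)).1 integrable_condExp
    rw [hinter]
    have h2 : P ({ω | s < τ ω ∧ ω ∈ E} ∩ Z ⁻¹' A) = ENNReal.ofReal
        (∫ ω in Z ⁻¹' A, Real.exp (-(s * a (Z ω))) * (b (Z ω) / a (Z ω)) ∂P) := by
      rw [h1]; simp
    rw [h2, ofReal_integral_eq_lintegral_ofReal hint.integrableOn
      (ae_restrict_of_ae (hab.mono fun ω h => by
        have := h.1; have := h.2; simp only [Pi.zero_apply]; positivity))]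
    refine setLIntegral_congr_fun_ae (hm _ hAm) (hab.mono fun ω h _ => ?_)
    exact (lintegral_exp_decay_Ioi h.1 h.2 s).symm
  -- `hlaw` is silent for `s < 0`, so both measures are first confined to positive times.
  have hpos₁ : ∀ {A : Set β} {U : Set ℝ}, MeasurableSet A → MeasurableSet U →
      ν₁ (A ×ˢ U) = ν₁ (A ×ˢ (U ∩ Set.Ioi 0)) := by
    intro A U hA hU
    rw [hν₁app hA hU, hν₁app hA (hU.inter measurableSet_Ioi)]
    refine measure_congr (Filter.eventuallyEq_set.2 (hpos.mono fun ω h => ?_))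
    simp [h]
  have hpos₂ : ∀ {A : Set β} {U : Set ℝ}, MeasurableSet A → MeasurableSet U →
      ν₂ (A ×ˢ U) = ν₂ (A ×ˢ (U ∩ Set.Ioi 0)) := by
    intro A U hA hU
    rw [hν₂app hA hU, hν₂app hA (hU.inter measurableSet_Ioi), Set.inter_assoc, Set.inter_self]
  have hfin : IsFiniteMeasure ν₁ := by rw [hν₁]; infer_instance
  have hν : ν₁ = ν₂ := by
    refine Measure.ext_prod fun {A U} hA hU => ?_
    -- With `A` fixed these are measures on `ℝ`, and the rays form a generating π-system. Finiteness
    -- is needed for the first measure only.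
    have hκ : (ν₁.restrict (A ×ˢ Set.univ)).map Prod.snd =
        (ν₂.restrict (A ×ˢ Set.univ)).map Prod.snd := by
      have happ : ∀ (ν : Measure (β × ℝ)) {V : Set ℝ}, MeasurableSet V →
          (ν.restrict (A ×ˢ Set.univ)).map Prod.snd V = ν (A ×ˢ V) := by
        intro ν V hV
        rw [Measure.map_apply measurable_snd hV, Measure.restrict_apply (measurable_snd hV)]
        congr 1
        ext p
        simp [and_comm]
      refine ext_of_generate_finite (Set.range Set.Ioi)
        ((BorelSpace.measurable_eq (α := ℝ)).trans (borel_eq_generateFrom_Ioi ℝ)) isPiSystem_Ioi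
        ?_ ?_
      · rintro _ ⟨s, rfl⟩
        rw [happ _ measurableSet_Ioi, happ _ measurableSet_Ioi, hpos₁ hA measurableSet_Ioi,
          hpos₂ hA measurableSet_Ioi, Set.Ioi_inter_Ioi]
        exact htail hA _ le_sup_right
      · rw [happ _ MeasurableSet.univ, happ _ MeasurableSet.univ, hpos₁ hA MeasurableSet.univ,
          hpos₂ hA MeasurableSet.univ, Set.univ_inter]
        exact htail hA _ le_rfl
    have := congrArg (fun κ => κ U) hκ
    simp only [Measure.map_apply measurable_snd hU,
      Measure.restrict_apply (measurable_snd hU)] at this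
    convert this using 2 <;> (ext p; simp [and_comm])
  rw [← lintegral_map (μ := P.restrict E) hg hZτ, ← hν₁, hν, hν₂,
    lintegral_withDensity_eq_lintegral_mul _ hwm hg,
    lintegral_prod _ (hwm.mul hg).aemeasurable, lintegral_map _ hZ0]
  · rfl
  · exact (hwm.mul hg).lintegral_prod_right'

/-! ### Grönwall's inequality and the linear integral equation -/

theorem lintegral_exp_Ioc_le {l : ℝ} (hl : 0 < l) {K : ℝ} (hK : 0 ≤ K) {t : ℝ} (ht : 0 ≤ t) :
    ∫⁻ u in Set.Ioc 0 t, ENNReal.ofReal (K * Real.exp (l * u)) ≤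
      ENNReal.ofReal (K * Real.exp (l * t) / l) := by
  rw [← ofReal_integral_eq_lintegral_ofReal
    (Continuous.integrableOn_Ioc (by fun_prop)) (Filter.Eventually.of_forall fun r => by positivity)]
  refine ENNReal.ofReal_le_ofReal ?_
  rw [← intervalIntegral.integral_of_le ht, intervalIntegral.integral_const_mul,
    intervalIntegral.integral_comp_mul_left (fun x => Real.exp x) hl.ne', integral_exp, mul_div_assoc]
  refine mul_le_mul_of_nonneg_left ?_ hK
  rw [smul_eq_mul, div_eq_inv_mul]
  refine mul_le_mul_of_nonneg_left ?_ (by positivity)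
  simp

/-- An integral Grönwall inequality for bounded functions that need not be measurable. -/
theorem lintegral_gronwall {g : ℝ → ENNReal} {K C D T : ℝ} (hK : 0 ≤ K) (hC : 0 < C) (hD : 0 ≤ D)
    (hbdd : ∀ t, 0 ≤ t → t ≤ T → g t ≤ ENNReal.ofReal D)
    (hg : ∀ t, 0 ≤ t → t ≤ T →
      g t ≤ ENNReal.ofReal K + ENNReal.ofReal C * ∫⁻ u in Set.Ioc 0 t, g u)
    {t : ℝ} (ht : 0 ≤ t) (htT : t ≤ T) :
    g t ≤ ENNReal.ofReal (2 * K * Real.exp (2 * C * t)) := by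
  -- With the weight `exp (2 * C * t)` the operator `C ∫₀ᵗ` contracts by `1 / 2`: each use of `hg`
  -- halves the share of `D`, while `2 * K` reproduces itself as `K + (2 * K) / 2`.
  have key : ∀ n : ℕ, ∀ t, 0 ≤ t → t ≤ T →
      g t ≤ ENNReal.ofReal ((2 * K + D * (1 / 2) ^ n) * Real.exp (2 * C * t)) := by
    intro n
    induction n with
    | zero =>
      intro t ht htT
      refine (hbdd t ht htT).trans (ENNReal.ofReal_le_ofReal ?_)
      have : 1 ≤ Real.exp (2 * C * t) := Real.one_le_exp (by positivity)
      nlinarith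
    | succ n ih =>
      intro t ht htT
      have hn : 0 ≤ 2 * K + D * (1 / 2) ^ n := by positivity
      have h1 : ∫⁻ u in Set.Ioc 0 t, g u ≤
          ENNReal.ofReal ((2 * K + D * (1 / 2) ^ n) * Real.exp (2 * C * t) / (2 * C)) :=
        (setLIntegral_mono' measurableSet_Ioc fun u hu => ih u hu.1.le (hu.2.trans htT)).trans
          (lintegral_exp_Ioc_le (by positivity) hn ht)
      refine (hg t ht htT).trans ((add_le_add le_rfl (mul_le_mul' le_rfl h1)).trans ?_)
      rw [← ENNReal.ofReal_mul hC.le, ← ENNReal.ofReal_add hK (by positivity)]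
      refine ENNReal.ofReal_le_ofReal ?_
      have h2 : 1 ≤ Real.exp (2 * C * t) := Real.one_le_exp (by positivity)
      have h3 : C * ((2 * K + D * (1 / 2) ^ n) * Real.exp (2 * C * t) / (2 * C)) =
        (K + D * (1 / 2) ^ (n + 1)) * Real.exp (2 * C * t) := by
        rw [pow_succ]; field_simp
      rw [h3]
      nlinarith
  have hlim : Filter.Tendsto
      (fun n : ℕ => ENNReal.ofReal ((2 * K + D * (1 / 2) ^ n) * Real.exp (2 * C * t)))
      Filter.atTop (nhds (ENNReal.ofReal ((2 * K + D * 0) * Real.exp (2 * C * t)))) := by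
    refine ENNReal.tendsto_ofReal ?_
    refine Filter.Tendsto.mul_const _ (tendsto_const_nhds.add (Filter.Tendsto.const_mul _ ?_))
    exact tendsto_pow_atTop_nhds_zero_of_lt_one (by norm_num) (by norm_num)
  simpa using ge_of_tendsto' hlim fun n => key n t ht htT

open scoped Matrix.Norms.Operator in
/-- Bounded solutions of the linear integral equation `f t = x + ∫₀ᵗ B f` are matrix
exponentials. -/
theorem eq_exp_mulVec_of_integral_eq {ι : Type*} [Fintype ι] [DecidableEq ι] (B : Matrix ι ι ℝ)
    (x : ι → ℝ) {f : ℝ → ι → ℝ} {T D : ℝ} (hD : ∀ t, 0 ≤ t → t ≤ T → ‖f t‖ ≤ D)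
    (hf : IntegrableOn f (Set.Ioc 0 T))
    (heq : ∀ t, 0 ≤ t → t ≤ T → f t = x + B.mulVec (∫ u in Set.Ioc 0 t, f u))
    {t : ℝ} (ht : 0 ≤ t) (htT : t ≤ T) :
    f t = (NormedSpace.exp (t • B)).mulVec x := by
  set L : (ι → ℝ) →L[ℝ] (ι → ℝ) := LinearMap.toContinuousLinearMap B.mulVecLin with hL
  have hLapp : ∀ v, L v = B.mulVec v := fun v => rfl
  set ψ : ℝ → ι → ℝ := fun t => (NormedSpace.exp (t • B)).mulVec x with hψ
  have hder : ∀ t, HasDerivAt ψ (L (ψ t)) t := by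
    intro t
    have h := hasDerivAt_exp_smul_const' (𝕂 := ℝ) B t
    set V : Matrix ι ι ℝ →L[ℝ] (ι → ℝ) :=
      LinearMap.toContinuousLinearMap ((Matrix.mulVecBilin ℝ ℝ).flip x) with hV
    have h2 := V.hasFDerivAt.comp_hasDerivAt t h
    have h3 : V (B * NormedSpace.exp (t • B)) = L (ψ t) := by
      simp [hV, hLapp, hψ, Matrix.mulVec_mulVec]
    exact h2.congr_deriv h3
  have hψc : Continuous ψ := continuous_iff_continuousAt.2 fun t => (hder t).continuousAt
  have hψeq : ∀ t, 0 ≤ t → ψ t = x + L (∫ u in Set.Ioc 0 t, ψ u) := by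
    intro t ht
    have h := intervalIntegral.integral_eq_sub_of_hasDerivAt (fun u _ => hder u)
      ((L.continuous.comp hψc).intervalIntegrable 0 t)
    rw [intervalIntegral.integral_of_le ht, ContinuousLinearMap.integral_comp_comm _
      hψc.integrableOn_Ioc] at h
    rw [h]
    simp [hψ]
  obtain ⟨D', hD'⟩ := (isCompact_Icc (a := (0 : ℝ)) (b := T)).exists_bound_of_continuousOn
    hψc.continuousOn
  -- The difference of two solutions solves the homogeneous equation, so `K = 0` forces it to
  -- vanish. The `+ 1` only keeps `C` positive.
  have h0 := lintegral_gronwall (g := fun t => ‖f t - ψ t‖ₑ) (K := 0) (C := ‖L‖ + 1)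
    (D := |D| + |D'|) (T := T)
    le_rfl (by positivity) (by positivity) (fun t ht htT => ?_) (fun t ht htT => ?_) ht htT
  · simpa [sub_eq_zero] using h0
  · rw [← ofReal_norm]
    refine ENNReal.ofReal_le_ofReal ((norm_sub_le _ _).trans (add_le_add ?_ ?_))
    · exact (hD t ht htT).trans (le_abs_self D)
    · exact (hD' t ⟨ht, htT⟩).trans (le_abs_self D')
  · have h1 : f t - ψ t = L (∫ u in Set.Ioc 0 t, (f u - ψ u)) := by
      rw [integral_sub (hf.mono_set (Set.Ioc_subset_Ioc_right htT)) hψc.integrableOn_Ioc,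
        map_sub, heq t ht htT, hψeq t ht, hLapp, hLapp]
      abel
    rw [h1, ENNReal.ofReal_zero, zero_add]
    refine (L.le_opENorm _).trans (mul_le_mul' ?_ (enorm_integral_le_lintegral_enorm _))
    rw [← ofReal_norm]
    exact ENNReal.ofReal_le_ofReal (by linarith)

/-! ### Measurability with respect to the past -/

section Measurability

variable {Ω : Type*} {c : ℕ}

theorem _root_.Measurable.matrix_row_apply {m : MeasurableSpace Ω}
    {B : Ω → Matrix (Fin c) (Fin c) ℝ} {J : Ω → Fin c} (hB : Measurable B) (hJ : Measurable J) :
    Measurable fun ω => B ω (J ω) := by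
  have h : Measurable fun p : Matrix (Fin c) (Fin c) ℝ × Fin c => p.1 p.2 :=
    measurable_from_prod_countable_left fun i => measurable_pi_apply i
  exact h.comp (hB.prodMk hJ)

theorem measurable_matrix_entry (i j : Fin c) :
    Measurable fun B : Matrix (Fin c) (Fin c) ℝ => B i j :=
  (measurable_pi_apply j).comp (measurable_pi_apply i)

variable {τ : ℕ → Ω → ℝ} {I : ℕ → Ω → Fin c} {M : ℕ → Ω → Matrix (Fin c) (Fin c) ℝ}

theorem le_history {k n : ℕ} (h : k < n) :
    MeasurableSpace.comap (τ k) inferInstance ⊔ MeasurableSpace.comap (I k) inferInstance ⊔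
      MeasurableSpace.comap (M k) inferInstance ≤ history τ I M n :=
  le_iSup₂_of_le (f := fun k (_ : k ∈ Finset.range n) =>
    MeasurableSpace.comap (τ k) inferInstance ⊔ MeasurableSpace.comap (I k) inferInstance ⊔
      MeasurableSpace.comap (M k) inferInstance) k (Finset.mem_range.2 h) le_rfl

theorem measurable_wait_history {k n : ℕ} (h : k < n) : Measurable[history τ I M n] (τ k) :=
  (comap_measurable _).mono ((le_sup_left.trans le_sup_left).trans (le_history h)) le_rfl

theorem measurable_color_history {k n : ℕ} (h : k < n) : Measurable[history τ I M n] (I k) :=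
  (comap_measurable _).mono ((le_sup_right.trans le_sup_left).trans (le_history h)) le_rfl

theorem measurable_matrix_history {k n : ℕ} (h : k < n) : Measurable[history τ I M n] (M k) :=
  (comap_measurable _).mono (le_sup_right.trans (le_history h)) le_rfl

theorem measurable_renewalTime_history (n : ℕ) :
    Measurable[history τ I M n] (renewalTime τ n) := by
  unfold renewalTime
  exact Finset.measurable_fun_sum _ fun k hk => measurable_wait_history (Finset.mem_range.1 hk)

theorem position_eq_sum (x₀ : Fin c → ℝ) (n : ℕ) (ω : Ω) :
    position x₀ I M n ω = x₀ + ∑ k ∈ Finset.range n, M k ω (I k ω) := by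
  induction n with
  | zero => simp [position]
  | succ n ih => rw [position, ih, Finset.sum_range_succ, add_assoc]

theorem measurable_position_history (x₀ : Fin c → ℝ) (n : ℕ) :
    Measurable[history τ I M n] (position x₀ I M n) := by
  have : position x₀ I M n = fun ω => x₀ + ∑ k ∈ Finset.range n, M k ω (I k ω) :=
    funext fun ω => position_eq_sum x₀ n ω
  rw [this]
  refine measurable_const.add (Finset.measurable_fun_sum _ fun k hk => ?_)
  exact (measurable_matrix_history (Finset.mem_range.1 hk)).matrix_row_apply
    (measurable_color_history (Finset.mem_range.1 hk))

end Measurability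

section RenewalHistory

variable {Ω : Type*} {c : ℕ}

/-- The σ-algebra generated by the history and by the waiting time and color of renewal `n`. -/
abbrev renewalHistory (τ : ℕ → Ω → ℝ) (I : ℕ → Ω → Fin c) (M : ℕ → Ω → Matrix (Fin c) (Fin c) ℝ)
    (n : ℕ) : MeasurableSpace Ω :=
  history τ I M n ⊔ MeasurableSpace.comap (τ n) inferInstance ⊔
    MeasurableSpace.comap (I n) inferInstance

variable {τ : ℕ → Ω → ℝ} {I : ℕ → Ω → Fin c} {M : ℕ → Ω → Matrix (Fin c) (Fin c) ℝ}

theorem measurable_color_renewalHistory (n : ℕ) : Measurable[renewalHistory τ I M n] (I n) :=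
  (comap_measurable _).mono le_sup_right le_rfl

theorem measurable_renewalTime_renewalHistory (n : ℕ) :
    Measurable[renewalHistory τ I M n] (renewalTime τ (n + 1)) := by
  have : renewalTime τ (n + 1) = fun ω => renewalTime τ n ω + τ n ω := by
    ext ω; simp [renewalTime, Finset.sum_range_succ]
  rw [this]
  refine Measurable.add ?_ ?_
  · exact (measurable_renewalTime_history (I := I) (M := M) n).mono
      (le_sup_left.trans le_sup_left) le_rfl
  · exact (comap_measurable _).mono (le_sup_right.trans le_sup_left) le_rfl

end RenewalHistory

/-! ### First consequences of the driving data -/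

variable {Ω Ω' : Type*} {c : ℕ} [MeasurableSpace Ω] [MeasurableSpace Ω']
  {P : Measure Ω} {P' : Measure Ω'}
  {A : Ω' → Matrix (Fin c) (Fin c) ℝ} {x₀ : Fin c → ℝ} {X : ℝ → Ω → Fin c → ℝ}
  {τ : ℕ → Ω → ℝ} {I : ℕ → Ω → Fin c} {M : ℕ → Ω → Matrix (Fin c) (Fin c) ℝ}

/-- The expectation of the `i`-th coordinate of the walk at time `u` on the event that exactly `n`
renewals have occurred. -/
noncomputable def sojournMean (P : Measure Ω) (x₀ : Fin c → ℝ) (τ : ℕ → Ω → ℝ) (I : ℕ → Ω → Fin c)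
    (M : ℕ → Ω → Matrix (Fin c) (Fin c) ℝ) (n : ℕ) (i : Fin c) (u : ℝ) : ENNReal :=
  ∫⁻ ω, {ω | renewalTime τ n ω ≤ u ∧ u < renewalTime τ (n + 1) ω}.indicator
    (fun ω => ENNReal.ofReal (position x₀ I M n ω i)) ω ∂P

namespace IsDrivenBy

theorem history_le (D : IsDrivenBy P P' A x₀ X τ I M) (n : ℕ) :
    history τ I M n ≤ (inferInstance : MeasurableSpace Ω) :=
  iSup₂_le fun k _ => sup_le (sup_le (D.measurable_wait k).comap_le (D.measurable_color k).comap_le)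
    (D.measurable_matrix k).comap_le

theorem measurable_renewalTime (D : IsDrivenBy P P' A x₀ X τ I M) (n : ℕ) :
    Measurable (renewalTime τ n) :=
  (measurable_renewalTime_history (τ := τ) (I := I) (M := M) n).mono (D.history_le n) le_rfl

theorem measurable_position (D : IsDrivenBy P P' A x₀ X τ I M) (n : ℕ) :
    Measurable (position x₀ I M n) :=
  (measurable_position_history (τ := τ) x₀ n).mono (D.history_le n) le_rfl

theorem ae_sum_position_pos (D : IsDrivenBy P P' A x₀ X τ I M) :
    ∀ᵐ ω ∂P, ∀ n, (∀ j, 0 ≤ position x₀ I M n ω j) ∧ 0 < ∑ j, position x₀ I M n ω j := by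
  filter_upwards [D.tenable] with ω h n
  refine ⟨(h n).1, lt_of_le_of_ne (Finset.sum_nonneg fun j _ => (h n).1 j) fun h0 => (h n).2 ?_⟩
  ext j
  exact (Finset.sum_eq_zero_iff_of_nonneg fun j _ => (h n).1 j).1 h0.symm j (Finset.mem_univ j)

theorem integrable_matrix_entry (D : IsDrivenBy P P' A x₀ X τ I M) {i j : Fin c}
    (hA : Integrable (fun ω => A ω i j) P') (n : ℕ) : Integrable (fun ω => M n ω i j) P :=
  ((D.identDistrib n).comp (measurable_matrix_entry i j)).symm.integrable_snd hA

theorem renewalHistory_le (D : IsDrivenBy P P' A x₀ X τ I M) (n : ℕ) :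
    renewalHistory τ I M n ≤ (inferInstance : MeasurableSpace Ω) :=
  sup_le (sup_le (D.history_le n) (D.measurable_wait n).comap_le) (D.measurable_color n).comap_le

theorem measurable_row (D : IsDrivenBy P P' A x₀ X τ I M) (n : ℕ) (j : Fin c) :
    Measurable fun ω => M n ω (I n ω) j :=
  (measurable_pi_apply j).comp ((D.measurable_matrix n).matrix_row_apply (D.measurable_color n))

theorem measurableSet_renewal (D : IsDrivenBy P P' A x₀ X τ I M) (n : ℕ) (t : ℝ) :
    MeasurableSet {ω | renewalTime τ n ω ≤ t} :=
  measurableSet_le (D.measurable_renewalTime n) measurable_const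

theorem measurableSet_renewal_color (D : IsDrivenBy P P' A x₀ X τ I M) (n : ℕ) (i : Fin c) (t : ℝ) :
    MeasurableSet {ω | renewalTime τ (n + 1) ω ≤ t ∧ I n ω = i} :=
  (D.measurableSet_renewal (n + 1) t).inter (D.measurable_color n (measurableSet_singleton i))

theorem measurable_sojourn (D : IsDrivenBy P P' A x₀ X τ I M) (t : ℝ) (n : ℕ) (j : Fin c) :
    Measurable ({ω | renewalTime τ n ω ≤ t ∧ t < renewalTime τ (n + 1) ω}.indicator
      (fun ω => ENNReal.ofReal (position x₀ I M n ω j))) := by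
  refine Measurable.indicator ((measurable_pi_apply j).comp (D.measurable_position n)).ennreal_ofReal ?_
  exact (D.measurableSet_renewal n t).inter
    (measurableSet_lt measurable_const (D.measurable_renewalTime (n + 1)))

variable [IsProbabilityMeasure P]

/-! ### Renewal times and their intensities -/

/-- At `s = 0` the conditional law gives the color probabilities, which add up to `1` because the
total rate is almost surely positive. -/
theorem ae_wait_pos (D : IsDrivenBy P P' A x₀ X τ I M) : ∀ᵐ ω ∂P, ∀ n, 0 < τ n ω := by
  refine ae_all_iff.2 fun n => ?_
  have hset : ∀ i, MeasurableSet {ω | 0 < τ n ω ∧ I n ω = i} := fun i =>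
    (measurableSet_lt measurable_const (D.measurable_wait n)).inter
      (D.measurable_color n (measurableSet_singleton i))
  have hE : ∀ i, P.real {ω | 0 < τ n ω ∧ I n ω = i} =
      ∫ ω, position x₀ I M n ω i / ∑ j, position x₀ I M n ω j ∂P := by
    intro i
    have h := integral_condExp (μ := P) (D.history_le n)
      (f := {ω | 0 < τ n ω ∧ I n ω = i}.indicator fun _ => (1 : ℝ))
    rw [integral_congr_ae (D.cond_law n 0 i le_rfl), integral_indicator (hset i)] at h
    simpa using h.symm
  have hint : ∀ i, Integrable
      (fun ω => position x₀ I M n ω i / ∑ j, position x₀ I M n ω j) P := by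
    intro i
    have h := (integrable_congr (D.cond_law n 0 i le_rfl)).1 integrable_condExp
    simpa using h
  have hunion : {ω | 0 < τ n ω} = ⋃ i ∈ (Finset.univ : Finset (Fin c)),
      {ω | 0 < τ n ω ∧ I n ω = i} := by
    ext ω; simp
  have h1 : P.real {ω | 0 < τ n ω} = 1 := by
    rw [hunion, measureReal_biUnion_finset _ fun i _ => hset i]
    · simp_rw [hE]
      rw [← integral_finsetSum _ fun i _ => hint i]
      rw [integral_congr_ae (g := fun _ => (1 : ℝ))]
      · simp
      · filter_upwards [D.ae_sum_position_pos] with ω h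
        rw [← Finset.sum_div, div_self (h n).2.ne']
    · intro i _ j _ hij
      exact Set.disjoint_left.2 fun ω h h' => hij (h.2.symm.trans h'.2)
  have hmeas : MeasurableSet {ω | 0 < τ n ω} :=
    measurableSet_lt measurable_const (D.measurable_wait n)
  have h2 : P {ω | 0 < τ n ω} = 1 := by
    rw [← ENNReal.toReal_eq_one_iff]; exact h1
  exact (mem_ae_iff_prob_eq_one hmeas).2 h2

theorem ae_strictMono_renewalTime (D : IsDrivenBy P P' A x₀ X τ I M) :
    ∀ᵐ ω ∂P, StrictMono fun n => renewalTime τ n ω := by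
  filter_upwards [D.ae_wait_pos] with ω h
  refine strictMono_nat_of_lt_succ fun n => ?_
  simp [renewalTime, Finset.sum_range_succ, h n]

theorem setLIntegral_color (D : IsDrivenBy P P' A x₀ X τ I M) (n : ℕ) (i : Fin c)
    {g : (ℝ × (Fin c → ℝ)) × ℝ → ENNReal} (hg : Measurable g) :
    ∫⁻ ω in {ω | I n ω = i}, g ((renewalTime τ n ω, position x₀ I M n ω), τ n ω) ∂P =
      ∫⁻ ω, ∫⁻ r in Set.Ioi 0, ENNReal.ofReal (position x₀ I M n ω i *
        Real.exp (-(r * ∑ j, position x₀ I M n ω j))) *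
          g ((renewalTime τ n ω, position x₀ I M n ω), r) ∂volume ∂P := by
  refine setLIntegral_eq_of_exponential_tail (D.history_le n) (D.measurable_wait n)
    (D.ae_wait_pos.mono fun ω h => h n) (D.measurable_color n (measurableSet_singleton i))
    (Z := fun ω => (renewalTime τ n ω, position x₀ I M n ω))
    (a := fun z => ∑ j, z.2 j) (b := fun z => z.2 i)
    ((measurable_renewalTime_history n).prodMk (measurable_position_history x₀ n))
    (by fun_prop) (by fun_prop) (D.ae_sum_position_pos.mono fun ω h => ⟨(h n).2, (h n).1 i⟩)
    (fun s hs => D.cond_law n s i hs) hg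

/-- Given the past, a wait started at `T ≤ u` in a position of total rate `S` outlasts `u` with
probability `exp (-(u - T) S)`. -/
theorem sojournMean_eq (D : IsDrivenBy P P' A x₀ X τ I M) (n : ℕ) (i : Fin c) (u : ℝ) :
    sojournMean P x₀ τ I M n i u = ∫⁻ ω, {ω | renewalTime τ n ω ≤ u}.indicator (fun ω =>
      ENNReal.ofReal (position x₀ I M n ω i * Real.exp (-((u - renewalTime τ n ω) *
        ∑ j, position x₀ I M n ω j)))) ω ∂P := by
  set g : (ℝ × (Fin c → ℝ)) × ℝ → ENNReal :=
    {p : (ℝ × (Fin c → ℝ)) × ℝ | p.1.1 ≤ u ∧ u < p.1.1 + p.2}.indicator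
      fun p => ENNReal.ofReal (p.1.2 i) with hg
  have hgm : Measurable g := by
    have hs₁ : MeasurableSet {p : (ℝ × (Fin c → ℝ)) × ℝ | p.1.1 ≤ u} :=
      measurableSet_le (by fun_prop) (by fun_prop)
    have hs₂ : MeasurableSet {p : (ℝ × (Fin c → ℝ)) × ℝ | u < p.1.1 + p.2} :=
      measurableSet_lt (by fun_prop) (by fun_prop)
    exact Measurable.indicator (by fun_prop) (hs₁.inter hs₂)
  have h1 : sojournMean P x₀ τ I M n i u = ∑ k, ∫⁻ ω in {ω | I n ω = k},
      g ((renewalTime τ n ω, position x₀ I M n ω), τ n ω) ∂P := by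
    have hset : ∀ k, MeasurableSet {ω | I n ω = k} := fun k =>
      D.measurable_color n (measurableSet_singleton k)
    have hu : (Set.univ : Set Ω) = ⋃ k, {ω | I n ω = k} := by ext ω; simp
    rw [← tsum_fintype (L := .unconditional _), ← lintegral_iUnion hset, ← hu, setLIntegral_univ]
    · refine lintegral_congr fun ω => ?_
      simp [hg, Set.indicator, renewalTime, Finset.sum_range_succ]
    · intro k l hkl
      exact Set.disjoint_left.2 fun ω h h' => hkl (h.symm.trans h')
  rw [h1, Finset.sum_congr rfl fun k _ => D.setLIntegral_color n k hgm]
  have hT := D.measurable_renewalTime n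
  have hY := D.measurable_position n
  rw [← lintegral_finsetSum']
  swap
  · intro k _
    have : Measurable fun p : Ω × ℝ => ENNReal.ofReal (position x₀ I M n p.1 k *
        Real.exp (-(p.2 * ∑ j, position x₀ I M n p.1 j))) *
          g ((renewalTime τ n p.1, position x₀ I M n p.1), p.2) := by
      fun_prop
    exact this.lintegral_prod_right'.aemeasurable
  refine lintegral_congr_ae ?_
  filter_upwards [D.ae_sum_position_pos] with ω h
  obtain ⟨h0, hS⟩ := h n
  set S := ∑ j, position x₀ I M n ω j with hSdef
  set T := renewalTime τ n ω with hTdef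
  rw [← lintegral_finsetSum _ fun k _ => by fun_prop]
  simp_rw [← Finset.sum_mul]
  have hsum : ∀ r : ℝ, ∑ k, ENNReal.ofReal (position x₀ I M n ω k * Real.exp (-(r * S))) =
      ENNReal.ofReal (S * Real.exp (-(r * S))) := by
    intro r
    rw [← ENNReal.ofReal_sum_of_nonneg fun k _ => mul_nonneg (h0 k) (Real.exp_nonneg _),
      ← Finset.sum_mul]
  simp_rw [hsum]
  by_cases hTu : T ≤ u
  · rw [Set.indicator_of_mem (show ω ∈ {ω | renewalTime τ n ω ≤ u} from hTu)]
    have h2 : ∀ r, ENNReal.ofReal (S * Real.exp (-(r * S))) * g ((T, position x₀ I M n ω), r) =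
        (Set.Ioi (u - T)).indicator (fun r => ENNReal.ofReal (position x₀ I M n ω i) *
          ENNReal.ofReal (S * Real.exp (-(r * S)))) r := by
      intro r
      have : u < T + r ↔ u - T < r := by constructor <;> intro <;> linarith
      simp only [hg, Set.indicator, Set.mem_ofPred_eq, hTu, true_and, this, Set.mem_Ioi]
      split_ifs
      · rw [mul_comm]
      · simp
    simp_rw [h2]
    rw [setLIntegral_indicator measurableSet_Ioi, Set.inter_eq_left.2
      (Set.Ioi_subset_Ioi (sub_nonneg.2 hTu)), lintegral_const_mul _ (by fun_prop),
      lintegral_exp_decay_Ioi hS hS.le, div_self hS.ne', mul_one, ← ENNReal.ofReal_mul (h0 i)]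
  · rw [Set.indicator_of_notMem (show ω ∉ {ω | renewalTime τ n ω ≤ u} from hTu)]
    have h2 : ∀ r, g ((T, position x₀ I M n ω), r) = 0 := by
      intro r
      simp [hg, hTu]
    simp [h2]

theorem measurable_sojournMean (D : IsDrivenBy P P' A x₀ X τ I M) (n : ℕ) (i : Fin c) :
    Measurable (sojournMean P x₀ τ I M n i) := by
  have hT := D.measurable_renewalTime n
  have hT' := D.measurable_renewalTime (n + 1)
  have hY := D.measurable_position n
  have : Measurable fun p : ℝ × Ω => {p : ℝ × Ω | renewalTime τ n p.2 ≤ p.1 ∧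
      p.1 < renewalTime τ (n + 1) p.2}.indicator
        (fun p => ENNReal.ofReal (position x₀ I M n p.2 i)) p := by
    have hs₁ : MeasurableSet {p : ℝ × Ω | renewalTime τ n p.2 ≤ p.1} :=
      measurableSet_le (by fun_prop) (by fun_prop)
    have hs₂ : MeasurableSet {p : ℝ × Ω | p.1 < renewalTime τ (n + 1) p.2} :=
      measurableSet_lt (by fun_prop) (by fun_prop)
    exact Measurable.indicator (by fun_prop) (hs₁.inter hs₂)
  exact this.lintegral_prod_right'

/-- The probability of an `i`-coloured renewal `n` before time `t` is the integral of its
intensity. -/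
theorem measure_renewal_color (D : IsDrivenBy P P' A x₀ X τ I M) (n : ℕ) (i : Fin c) (t : ℝ) :
    P {ω | renewalTime τ (n + 1) ω ≤ t ∧ I n ω = i} =
      ∫⁻ u in Set.Ioc 0 t, sojournMean P x₀ τ I M n i u := by
  have hT := D.measurable_renewalTime n
  have hT' := D.measurable_renewalTime (n + 1)
  have hY := D.measurable_position n
  set g : (ℝ × (Fin c → ℝ)) × ℝ → ENNReal :=
    {p : (ℝ × (Fin c → ℝ)) × ℝ | p.1.1 + p.2 ≤ t}.indicator fun _ => 1 with hg
  have hgm : Measurable g :=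
    measurable_const.indicator (measurableSet_le (by fun_prop) (by fun_prop))
  have h1 : P {ω | renewalTime τ (n + 1) ω ≤ t ∧ I n ω = i} =
      ∫⁻ ω in {ω | I n ω = i}, g ((renewalTime τ n ω, position x₀ I M n ω), τ n ω) ∂P := by
    have hset : MeasurableSet {ω | renewalTime τ (n + 1) ω ≤ t} :=
      measurableSet_le hT' measurable_const
    have : ∀ ω, g ((renewalTime τ n ω, position x₀ I M n ω), τ n ω) =
        {ω | renewalTime τ (n + 1) ω ≤ t}.indicator (fun _ => 1) ω := by
      intro ω
      simp [hg, Set.indicator, renewalTime, Finset.sum_range_succ]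
    simp_rw [this]
    rw [lintegral_indicator_const hset, one_mul, Measure.restrict_apply hset]
    rfl
  rw [h1, D.setLIntegral_color n i hgm]
  simp_rw [D.sojournMean_eq]
  have hmeas : Measurable fun p : ℝ × Ω => {p : ℝ × Ω | renewalTime τ n p.2 ≤ p.1}.indicator
      (fun p => ENNReal.ofReal (position x₀ I M n p.2 i * Real.exp (-((p.1 - renewalTime τ n p.2) *
        ∑ j, position x₀ I M n p.2 j)))) p :=
    Measurable.indicator (by fun_prop) (measurableSet_le (by fun_prop) (by fun_prop))
  rw [lintegral_lintegral_swap (f := fun u ω => {ω | renewalTime τ n ω ≤ u}.indicator (fun ω =>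
      ENNReal.ofReal (position x₀ I M n ω i * Real.exp (-((u - renewalTime τ n ω) *
        ∑ j, position x₀ I M n ω j)))) ω) hmeas.aemeasurable]
  refine lintegral_congr_ae ?_
  filter_upwards [D.ae_strictMono_renewalTime] with ω hmono
  have hT0 : 0 ≤ renewalTime τ n ω := by
    simpa [renewalTime] using hmono.monotone (Nat.zero_le n)
  set T := renewalTime τ n ω with hTdef
  set S := ∑ j, position x₀ I M n ω j with hSdef
  -- Common form of both sides under the substitution `u = T + r` from waiting time to clock time.
  set G : ℝ → ENNReal := (Set.Ioc T t).indicator fun u =>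
    ENNReal.ofReal (position x₀ I M n ω i * Real.exp (-((u - T) * S))) with hG
  have hleft : ∫⁻ r in Set.Ioi 0, ENNReal.ofReal (position x₀ I M n ω i * Real.exp (-(r * S))) *
      g ((T, position x₀ I M n ω), r) = ∫⁻ r, G (r + T) := by
    rw [← lintegral_indicator measurableSet_Ioi]
    refine lintegral_congr fun r => ?_
    have : r + T ≤ t ↔ T + r ≤ t := by rw [add_comm]
    simp only [Set.indicator, hG, hg, Set.mem_Ioi, Set.mem_Ioc, lt_add_iff_pos_left,
      add_sub_cancel_right, Set.mem_ofPred_eq, this]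
    by_cases h1 : 0 < r <;> by_cases h2 : T + r ≤ t <;> simp [h1, h2]
  rw [hleft, lintegral_add_right_eq_self, ← lintegral_indicator measurableSet_Ioc]
  refine lintegral_congr_ae ?_
  -- The sojourn contains its left endpoint and `Ioc T t` does not; this single point is null.
  filter_upwards [compl_mem_ae_iff.2 (measure_singleton T)] with u hu
  have hu' : u ≠ T := hu
  simp only [Set.indicator, hG, Set.mem_Ioc, Set.mem_ofPred_eq, ← hTdef]
  by_cases h1 : T < u
  · have h2 : 0 < u := hT0.trans_lt h1
    simp [h1, h2, h1.le, hSdef]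
  · have h2 : ¬ T ≤ u := fun h => h1 (lt_of_le_of_ne h hu'.symm)
    simp [h1, h2]

/-! ### Mean contribution of one renewal -/

/-- The event lies in `renewalHistory`, from which `M n` is independent, so conditionally `f (M n)`
has the constant mean `E[f(A)]`. It is applied to an entry and to its norm. -/
theorem setIntegral_matrix (D : IsDrivenBy P P' A x₀ X τ I M)
    {f : Matrix (Fin c) (Fin c) ℝ → ℝ} (hf : Measurable f)
    (hfA : Integrable (fun ω => f (A ω)) P') (n : ℕ) (i : Fin c) (t : ℝ) :
    ∫ ω in {ω | renewalTime τ (n + 1) ω ≤ t ∧ I n ω = i}, f (M n ω) ∂P =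
      (∫ ω, f (A ω) ∂P') * P.real {ω | renewalTime τ (n + 1) ω ≤ t ∧ I n ω = i} := by
  have hm0 := D.renewalHistory_le n
  have hid := (D.identDistrib n).comp hf
  have hint : Integrable (fun ω => f (M n ω)) P := hid.symm.integrable_snd hfA
  have hset : MeasurableSet[renewalHistory τ I M n]
      {ω | renewalTime τ (n + 1) ω ≤ t ∧ I n ω = i} :=
    MeasurableSet.inter (measurable_renewalTime_renewalHistory n measurableSet_Iic)
      (measurable_color_renewalHistory n (measurableSet_singleton i))
  have hce := condExp_indep_eq (μ := P) (f := fun ω => f (M n ω))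
    (D.measurable_matrix n).comap_le hm0
    (hf.comp (comap_measurable (M n))).stronglyMeasurable (D.indep n)
  rw [← setIntegral_condExp hm0 hint hset, setIntegral_congr_ae (hm0 _ hset)
    (hce.mono fun ω h _ => h), setIntegral_const, smul_eq_mul, mul_comm]
  congr 1
  exact hid.integral_eq

theorem setLIntegral_matrix_entry (D : IsDrivenBy P P' A x₀ X τ I M) {i j : Fin c}
    (hA : Integrable (fun ω => A ω i j) P') (n : ℕ) (t : ℝ) :
    ∫⁻ ω in {ω | renewalTime τ (n + 1) ω ≤ t ∧ I n ω = i}, ‖M n ω i j‖ₑ ∂P =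
      ENNReal.ofReal (∫ ω, ‖A ω i j‖ ∂P') *
        P {ω | renewalTime τ (n + 1) ω ≤ t ∧ I n ω = i} := by
  have h := D.setIntegral_matrix (f := fun B => ‖B i j‖) (measurable_matrix_entry i j).norm hA.norm
    n i t
  rw [← ofReal_integral_norm_eq_lintegral_enorm (D.integrable_matrix_entry hA n).integrableOn, h,
    ENNReal.ofReal_mul (integral_nonneg fun _ => norm_nonneg _), ofReal_measureReal]

theorem lintegral_step (D : IsDrivenBy P P' A x₀ X τ I M)
    (hA : ∀ i j, Integrable (fun ω => A ω i j) P') (n : ℕ) (j : Fin c) (t : ℝ) :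
    ∫⁻ ω, ‖{ω | renewalTime τ (n + 1) ω ≤ t}.indicator (fun ω => M n ω (I n ω) j) ω‖ₑ ∂P =
      ∑ i, ENNReal.ofReal (∫ ω, ‖A ω i j‖ ∂P') *
        P {ω | renewalTime τ (n + 1) ω ≤ t ∧ I n ω = i} := by
  have hpt : ∀ ω, ‖{ω | renewalTime τ (n + 1) ω ≤ t}.indicator (fun ω => M n ω (I n ω) j) ω‖ₑ =
      ∑ i, {ω | renewalTime τ (n + 1) ω ≤ t ∧ I n ω = i}.indicator (fun ω => ‖M n ω i j‖ₑ) ω := by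
    intro ω
    by_cases h : renewalTime τ (n + 1) ω ≤ t <;> simp [Set.indicator, h]
  have hm : ∀ i, Measurable fun ω => ‖M n ω i j‖ₑ := fun i =>
    ((measurable_matrix_entry i j).comp (D.measurable_matrix n)).enorm
  rw [lintegral_congr hpt, lintegral_finsetSum _ fun i _ =>
    (hm i).indicator (D.measurableSet_renewal_color n i t)]
  refine Finset.sum_congr rfl fun i _ => ?_
  rw [lintegral_indicator (D.measurableSet_renewal_color n i t),
    D.setLIntegral_matrix_entry (hA i j)]

theorem integrable_step (D : IsDrivenBy P P' A x₀ X τ I M)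
    (hA : ∀ i j, Integrable (fun ω => A ω i j) P') (n : ℕ) (j : Fin c) (t : ℝ) :
    Integrable ({ω | renewalTime τ (n + 1) ω ≤ t}.indicator (fun ω => M n ω (I n ω) j)) P := by
  refine ⟨((D.measurable_row n j).indicator (D.measurableSet_renewal _ t)).aestronglyMeasurable, ?_⟩
  rw [HasFiniteIntegral, D.lintegral_step hA]
  exact ENNReal.sum_lt_top.2 fun i _ => ENNReal.mul_lt_top ENNReal.ofReal_lt_top (measure_lt_top _ _)

theorem integral_step (D : IsDrivenBy P P' A x₀ X τ I M)
    (hA : ∀ i j, Integrable (fun ω => A ω i j) P') (n : ℕ) (j : Fin c) (t : ℝ) :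
    ∫ ω, {ω | renewalTime τ (n + 1) ω ≤ t}.indicator (fun ω => M n ω (I n ω) j) ω ∂P =
      ∑ i, (∫ ω, A ω i j ∂P') * P.real {ω | renewalTime τ (n + 1) ω ≤ t ∧ I n ω = i} := by
  have hpt : ∀ ω, {ω | renewalTime τ (n + 1) ω ≤ t}.indicator (fun ω => M n ω (I n ω) j) ω =
      ∑ i, {ω | renewalTime τ (n + 1) ω ≤ t ∧ I n ω = i}.indicator (fun ω => M n ω i j) ω := by
    intro ω
    by_cases h : renewalTime τ (n + 1) ω ≤ t <;> simp [Set.indicator, h]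
  rw [integral_congr_ae (Filter.Eventually.of_forall hpt), integral_finsetSum _ fun i _ =>
    (D.integrable_matrix_entry (hA i j) n).indicator (D.measurableSet_renewal_color n i t)]
  refine Finset.sum_congr rfl fun i _ => ?_
  rw [integral_indicator (D.measurableSet_renewal_color n i t)]
  exact D.setIntegral_matrix (measurable_matrix_entry i j) (hA i j) n i t

/-! ### A priori bound and non-explosion -/

/-- At most one sojourn contains `t`. If it is the `n`-th, the position is `x₀` plus `n` rows, all
added by time `t`, and the triangle inequality applies. Non-explosion is not yet available: if no
sojourn below `N` contains `t`, the left side is `0`. -/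
theorem ae_sum_sojourn_le (D : IsDrivenBy P P' A x₀ X τ I M) (N : ℕ) (j : Fin c) (t : ℝ) :
    ∀ᵐ ω ∂P, ∑ n ∈ Finset.range N, {ω | renewalTime τ n ω ≤ t ∧
        t < renewalTime τ (n + 1) ω}.indicator
          (fun ω => ENNReal.ofReal (position x₀ I M n ω j)) ω ≤
      ENNReal.ofReal ‖x₀ j‖ + ∑ n ∈ Finset.range N,
        ‖{ω | renewalTime τ (n + 1) ω ≤ t}.indicator (fun ω => M n ω (I n ω) j) ω‖ₑ := by
  filter_upwards [D.ae_strictMono_renewalTime] with ω hmono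
  by_cases h : ∃ n < N, renewalTime τ n ω ≤ t ∧ t < renewalTime τ (n + 1) ω
  · obtain ⟨n, hn, h1, h2⟩ := h
    rw [Finset.sum_eq_single n]
    · rw [Set.indicator_of_mem (show ω ∈ {ω | renewalTime τ n ω ≤ t ∧
        t < renewalTime τ (n + 1) ω} from ⟨h1, h2⟩), position_eq_sum]
      refine (Real.ofReal_le_enorm _).trans ?_
      rw [Pi.add_apply, Finset.sum_apply, ofReal_norm]
      refine (enorm_add_le _ _).trans (add_le_add le_rfl ((enorm_sum_le _ _).trans ?_))
      refine (Finset.sum_le_sum fun k hk => ?_).trans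
        (Finset.sum_le_sum_of_subset (Finset.range_subset_range.2 hn.le))
      have hk' : renewalTime τ (k + 1) ω ≤ t :=
        (hmono.monotone (Nat.succ_le_of_lt (Finset.mem_range.1 hk))).trans h1
      rw [Set.indicator_of_mem (show ω ∈ {ω | renewalTime τ (k + 1) ω ≤ t} from hk')]
    · intro k _ hk
      refine Set.indicator_of_notMem (fun hmem => ?_) _
      rcases lt_or_gt_of_ne hk with hlt | hlt
      · exact absurd ((hmono.monotone (Nat.succ_le_of_lt hlt)).trans h1) (not_le.2 hmem.2)
      · exact absurd ((hmono.monotone (Nat.succ_le_of_lt hlt)).trans hmem.1) (not_le.2 h2)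
    · intro hn'
      exact absurd (Finset.mem_range.2 hn) hn'
  · rw [Finset.sum_eq_zero]
    · exact zero_le
    · intro n hn
      refine Set.indicator_of_notMem (fun hmem => ?_) _
      exact h ⟨n, Finset.mem_range.1 hn, hmem⟩

theorem sum_sojournMean_le (D : IsDrivenBy P P' A x₀ X τ I M)
    (hA : ∀ i j, Integrable (fun ω => A ω i j) P') (N : ℕ) (j : Fin c) (t : ℝ) :
    ∑ n ∈ Finset.range N, sojournMean P x₀ τ I M n j t ≤ ENNReal.ofReal ‖x₀ j‖ +
      ∑ n ∈ Finset.range N, ∑ i, ENNReal.ofReal (∫ ω, ‖A ω i j‖ ∂P') *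
        P {ω | renewalTime τ (n + 1) ω ≤ t ∧ I n ω = i} := by
  have h := lintegral_mono_ae (D.ae_sum_sojourn_le N j t)
  rw [lintegral_add_left measurable_const, lintegral_finsetSum, lintegral_finsetSum] at h
  · simpa [D.lintegral_step hA, sojournMean] using h
  · exact fun n _ => ((D.measurable_row n j).indicator (D.measurableSet_renewal _ t)).enorm
  · exact fun n _ => D.measurable_sojourn t n j

/-- Exponential bound, uniform in `N`, for the mean mass of the walk stopped after `N` renewals. -/
theorem exists_sum_sojournMean_le (D : IsDrivenBy P P' A x₀ X τ I M)
    (hA : ∀ i j, Integrable (fun ω => A ω i j) P') :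
    ∃ K C : ℝ, 0 ≤ K ∧ 0 ≤ C ∧ ∀ N t, 0 ≤ t →
      ∑ n ∈ Finset.range N, ∑ j, sojournMean P x₀ τ I M n j t ≤
        ENNReal.ofReal (K * Real.exp (C * t)) := by
  set K : ℝ := ∑ j, ‖x₀ j‖ with hK
  set C : ℝ := ∑ i, ∑ j, ∫ ω, ‖A ω i j‖ ∂P' + 1 with hC
  have hnn : ∀ i j, 0 ≤ ∫ ω, ‖A ω i j‖ ∂P' := fun i j => integral_nonneg fun _ => norm_nonneg _
  have hK0 : 0 ≤ K := Finset.sum_nonneg fun _ _ => norm_nonneg _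
  have hC0 : 0 < C :=
    add_pos_of_nonneg_of_pos (Finset.sum_nonneg fun i _ => Finset.sum_nonneg fun j _ => hnn i j)
      one_pos
  have hstep : ∀ N t, ∑ n ∈ Finset.range N, ∑ j, sojournMean P x₀ τ I M n j t ≤
      ENNReal.ofReal K + ENNReal.ofReal C * ∑ n ∈ Finset.range N, ∑ i,
        P {ω | renewalTime τ (n + 1) ω ≤ t ∧ I n ω = i} := by
    intro N t
    rw [Finset.sum_comm]
    refine (Finset.sum_le_sum fun j _ => D.sum_sojournMean_le hA N j t).trans ?_
    rw [Finset.sum_add_distrib, hK, ENNReal.ofReal_sum_of_nonneg fun _ _ => norm_nonneg _]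
    refine add_le_add le_rfl ?_
    rw [Finset.sum_comm, Finset.mul_sum]
    refine Finset.sum_le_sum fun n _ => ?_
    rw [Finset.sum_comm, Finset.mul_sum]
    refine Finset.sum_le_sum fun i _ => ?_
    rw [← Finset.sum_mul, ← ENNReal.ofReal_sum_of_nonneg fun j _ => hnn i j]
    refine mul_le_mul' (ENNReal.ofReal_le_ofReal ?_) le_rfl
    have h1 : ∑ j, ∫ ω, ‖A ω i j‖ ∂P' ≤ ∑ i, ∑ j, ∫ ω, ‖A ω i j‖ ∂P' :=
      Finset.single_le_sum (f := fun i => ∑ j, ∫ ω, ‖A ω i j‖ ∂P')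
      (fun i _ => Finset.sum_nonneg fun j _ => hnn i j) (Finset.mem_univ i)
    linarith
  refine ⟨2 * K, 2 * C, by positivity, by positivity, fun N t ht => ?_⟩
  -- The crude bound `D` estimates each of the `N * c` probabilities by `1`. It depends on `N`, but
  -- the conclusion of Grönwall does not involve it.
  refine lintegral_gronwall (K := K) (C := C) (D := K + C * (N * c)) (T := t) hK0 hC0
    (by positivity)
    (g := fun t => ∑ n ∈ Finset.range N, ∑ j, sojournMean P x₀ τ I M n j t)
    (fun s _ _ => (hstep N s).trans ?_) (fun s _ _ => (hstep N s).trans ?_) ht le_rfl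
  · rw [ENNReal.ofReal_add hK0 (by positivity), ENNReal.ofReal_mul hC0.le]
    refine add_le_add le_rfl (mul_le_mul' le_rfl ?_)
    refine (Finset.sum_le_sum fun n _ => Finset.sum_le_sum fun i _ => prob_le_one).trans ?_
    simp [ENNReal.ofReal_mul]
  · refine add_le_add le_rfl (mul_le_mul' le_rfl (le_of_eq ?_))
    rw [lintegral_finsetSum _ fun n _ => Finset.measurable_fun_sum _ fun j _ =>
      D.measurable_sojournMean n j]
    refine Finset.sum_congr rfl fun n _ => ?_
    rw [lintegral_finsetSum _ fun j _ => D.measurable_sojournMean n j]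
    exact Finset.sum_congr rfl fun i _ => D.measure_renewal_color n i s

theorem exists_tsum_sojournMean_le (D : IsDrivenBy P P' A x₀ X τ I M)
    (hA : ∀ i j, Integrable (fun ω => A ω i j) P') :
    ∃ K C : ℝ, 0 ≤ K ∧ 0 ≤ C ∧ ∀ t, 0 ≤ t → ∀ j,
      ∑' n, sojournMean P x₀ τ I M n j t ≤ ENNReal.ofReal (K * Real.exp (C * t)) := by
  obtain ⟨K, C, hK, hC, h⟩ := D.exists_sum_sojournMean_le hA
  refine ⟨K, C, hK, hC, fun t ht j => ENNReal.tsum_le_of_sum_range_le fun N => ?_⟩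
  refine (Finset.sum_le_sum fun n _ => ?_).trans (h N t ht)
  exact Finset.single_le_sum (f := fun j => sojournMean P x₀ τ I M n j t)
    (fun _ _ => zero_le) (Finset.mem_univ j)

/-- The left side is the expected number of `i`-renewals up to time `t`. -/
theorem tsum_measure_renewal_color (D : IsDrivenBy P P' A x₀ X τ I M) (i : Fin c) (t : ℝ) :
    ∑' n, P {ω | renewalTime τ (n + 1) ω ≤ t ∧ I n ω = i} =
      ∫⁻ u in Set.Ioc 0 t, ∑' n, sojournMean P x₀ τ I M n i u := by
  rw [lintegral_tsum fun n => (D.measurable_sojournMean n i).aemeasurable]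
  exact tsum_congr fun n => D.measure_renewal_color n i t

theorem tsum_measure_renewal_color_lt_top (D : IsDrivenBy P P' A x₀ X τ I M)
    (hA : ∀ i j, Integrable (fun ω => A ω i j) P') (i : Fin c) (t : ℝ) :
    ∑' n, P {ω | renewalTime τ (n + 1) ω ≤ t ∧ I n ω = i} < ⊤ := by
  obtain ⟨K, C, hK, hC, h⟩ := D.exists_tsum_sojournMean_le hA
  rw [D.tsum_measure_renewal_color]
  have h1 : ∀ u ∈ Set.Ioc 0 t, ∑' n, sojournMean P x₀ τ I M n i u ≤
      ENNReal.ofReal (K * Real.exp (C * t)) := fun u hu =>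
    (h u hu.1.le i).trans (ENNReal.ofReal_le_ofReal (by gcongr; exact hu.2))
  refine (setLIntegral_mono' measurableSet_Ioc h1).trans_lt ?_
  rw [setLIntegral_const]
  exact ENNReal.mul_lt_top ENNReal.ofReal_lt_top (by simp)

/-- The walk does not explode. -/
theorem ae_exists_sojourn (D : IsDrivenBy P P' A x₀ X τ I M)
    (hA : ∀ i j, Integrable (fun ω => A ω i j) P') {t : ℝ} (ht : 0 ≤ t) :
    ∀ᵐ ω ∂P, ∃ n, renewalTime τ n ω ≤ t ∧ t < renewalTime τ (n + 1) ω := by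
  have hfin : ∑' n, P {ω | renewalTime τ (n + 1) ω ≤ t} ≠ ⊤ := by
    refine ne_top_of_le_ne_top (b := ∑ i, ∑' n, P {ω | renewalTime τ (n + 1) ω ≤ t ∧ I n ω = i})
      (ENNReal.sum_ne_top.2 fun i _ => (D.tsum_measure_renewal_color_lt_top hA i t).ne) ?_
    rw [← Summable.tsum_finsetSum fun i _ => ENNReal.summable]
    refine ENNReal.tsum_le_tsum fun n => ?_
    refine (measure_mono fun ω hω => ?_).trans (measure_biUnion_finset_le Finset.univ _)
    simpa using hω
  -- Borel–Cantelli: almost surely only finitely many renewals occur by time `t`. The first renewal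
  -- after `t` ends the sojourn sought.
  filter_upwards [ae_eventually_notMem hfin] with ω h
  have hex : ∃ n, t < renewalTime τ (n + 1) ω := by
    obtain ⟨n, hn⟩ := h.exists
    exact ⟨n, not_le.1 hn⟩
  classical
  refine ⟨Nat.find hex, ?_, Nat.find_spec hex⟩
  rcases hn : Nat.find hex with _ | n
  · simpa [renewalTime] using ht
  · exact not_lt.1 (Nat.find_min hex (hn ▸ Nat.lt_succ_self n))

/-! ### The integral equation for the mean -/

theorem ae_ofReal_eq_tsum (D : IsDrivenBy P P' A x₀ X τ I M)
    (hA : ∀ i j, Integrable (fun ω => A ω i j) P') {t : ℝ} (ht : 0 ≤ t) (j : Fin c) :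
    ∀ᵐ ω ∂P, 0 ≤ X t ω j ∧ ENNReal.ofReal (X t ω j) =
      ∑' n, {ω | renewalTime τ n ω ≤ t ∧ t < renewalTime τ (n + 1) ω}.indicator
        (fun ω => ENNReal.ofReal (position x₀ I M n ω j)) ω := by
  filter_upwards [D.ae_exists_sojourn hA ht, D.ae_strictMono_renewalTime, D.path, D.tenable]
    with ω ⟨n, h1, h2⟩ hmono hpath hten
  rw [hpath n t h1 h2]
  refine ⟨(hten n).1 j, ?_⟩
  rw [tsum_eq_single n]
  · rw [Set.indicator_of_mem (show ω ∈ {ω | renewalTime τ n ω ≤ t ∧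
        t < renewalTime τ (n + 1) ω} from ⟨h1, h2⟩)]
  · intro k hk
    refine Set.indicator_of_notMem (fun hmem => ?_) _
    rcases lt_or_gt_of_ne hk with hlt | hlt
    · exact absurd ((hmono.monotone (Nat.succ_le_of_lt hlt)).trans h1) (not_le.2 hmem.2)
    · exact absurd ((hmono.monotone (Nat.succ_le_of_lt hlt)).trans hmem.1) (not_le.2 h2)

/-- If `t` lies in the `n`-th sojourn, exactly the first `n` renewals have occurred. Writing their
rows as a series over all renewals lets expectations be taken term by term. -/
theorem ae_sub_eq_tsum (D : IsDrivenBy P P' A x₀ X τ I M)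
    (hA : ∀ i j, Integrable (fun ω => A ω i j) P') {t : ℝ} (ht : 0 ≤ t) (j : Fin c) :
    ∀ᵐ ω ∂P, X t ω j - x₀ j =
      ∑' n, {ω | renewalTime τ (n + 1) ω ≤ t}.indicator (fun ω => M n ω (I n ω) j) ω := by
  filter_upwards [D.ae_exists_sojourn hA ht, D.ae_strictMono_renewalTime, D.path]
    with ω ⟨n, h1, h2⟩ hmono hpath
  rw [hpath n t h1 h2, position_eq_sum, Pi.add_apply, Finset.sum_apply, add_sub_cancel_left,
    tsum_eq_sum (s := Finset.range n)]
  · refine Finset.sum_congr rfl fun k hk => ?_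
    rw [Set.indicator_of_mem (show ω ∈ {ω | renewalTime τ (k + 1) ω ≤ t} from
      (hmono.monotone (Nat.succ_le_of_lt (Finset.mem_range.1 hk))).trans h1)]
  · intro k hk
    refine Set.indicator_of_notMem (s := {ω | renewalTime τ (k + 1) ω ≤ t})
      (fun hmem => absurd (h2.trans_le ?_) (not_lt.2 hmem)) _
    exact hmono.monotone (Nat.succ_le_succ (not_lt.1 fun h => hk (Finset.mem_range.2 h)))

theorem lintegral_coord (D : IsDrivenBy P P' A x₀ X τ I M)
    (hA : ∀ i j, Integrable (fun ω => A ω i j) P') {t : ℝ} (ht : 0 ≤ t) (j : Fin c) :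
    ∫⁻ ω, ENNReal.ofReal (X t ω j) ∂P = ∑' n, sojournMean P x₀ τ I M n j t := by
  rw [lintegral_congr_ae ((D.ae_ofReal_eq_tsum hA ht j).mono fun ω h => h.2),
    lintegral_tsum fun n => (D.measurable_sojourn t n j).aemeasurable]
  rfl

theorem integrable_coord (D : IsDrivenBy P P' A x₀ X τ I M)
    (hA : ∀ i j, Integrable (fun ω => A ω i j) P') {t : ℝ} (ht : 0 ≤ t) (j : Fin c) :
    Integrable (fun ω => X t ω j) P := by
  obtain ⟨K, C, -, -, h⟩ := D.exists_tsum_sojournMean_le hA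
  have hX := D.ae_ofReal_eq_tsum hA ht j
  -- Measurability of `X t` is not part of the data; it comes from the almost sure agreement with a
  -- measurable series.
  have hmeas : AEMeasurable (fun ω => X t ω j) P := by
    refine ⟨fun ω => (∑' n, {ω | renewalTime τ n ω ≤ t ∧ t < renewalTime τ (n + 1) ω}.indicator
        (fun ω => ENNReal.ofReal (position x₀ I M n ω j)) ω).toReal,
      (Measurable.tsum fun n => D.measurable_sojourn t n j).ennreal_toReal, ?_⟩
    filter_upwards [hX] with ω hω
    rw [← hω.2, ENNReal.toReal_ofReal hω.1]
  refine ⟨hmeas.aestronglyMeasurable, ?_⟩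
  rw [hasFiniteIntegral_iff_ofReal (hX.mono fun ω h => h.1), D.lintegral_coord hA ht]
  exact (h t ht j).trans_lt ENNReal.ofReal_lt_top

theorem integral_coord (D : IsDrivenBy P P' A x₀ X τ I M)
    (hA : ∀ i j, Integrable (fun ω => A ω i j) P') {t : ℝ} (ht : 0 ≤ t) (j : Fin c) :
    ∫ ω, X t ω j ∂P = (∑' n, sojournMean P x₀ τ I M n j t).toReal := by
  rw [integral_eq_lintegral_of_nonneg_ae ((D.ae_ofReal_eq_tsum hA ht j).mono fun ω h => h.1)
    (D.integrable_coord hA ht j).aestronglyMeasurable, D.lintegral_coord hA ht]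

/-- A Wald-type identity: the mean displacement is the mean row of each color times the expected
number of renewals of that color. Finiteness of these numbers makes the series absolutely
convergent, which justifies the exchange of sum and expectation. -/
theorem integral_coord_eq_add_integral (D : IsDrivenBy P P' A x₀ X τ I M)
    (hA : ∀ i j, Integrable (fun ω => A ω i j) P') {t : ℝ} (ht : 0 ≤ t) (j : Fin c) :
    ∫ ω, X t ω j ∂P = x₀ j + ∑ i, (∫ ω, A ω i j ∂P') *
      (∫⁻ u in Set.Ioc 0 t, ∑' n, sojournMean P x₀ τ I M n i u).toReal := by
  have h1 : ∫ ω, X t ω j ∂P - x₀ j = ∫ ω, (X t ω j - x₀ j) ∂P := by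
    rw [integral_sub (D.integrable_coord hA ht j) (integrable_const _)]
    simp
  have hfin := fun i => (D.tsum_measure_renewal_color_lt_top hA i t).ne
  have h2 : ∑' n, ∫⁻ ω, ‖{ω | renewalTime τ (n + 1) ω ≤ t}.indicator
      (fun ω => M n ω (I n ω) j) ω‖ₑ ∂P ≠ ⊤ := by
    simp_rw [D.lintegral_step hA]
    rw [Summable.tsum_finsetSum fun i _ => ENNReal.summable]
    refine ENNReal.sum_ne_top.2 fun i _ => ?_
    rw [ENNReal.tsum_mul_left]
    exact ENNReal.mul_ne_top ENNReal.ofReal_ne_top (hfin i)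
  rw [← sub_eq_iff_eq_add', h1, integral_congr_ae (D.ae_sub_eq_tsum hA ht j),
    integral_tsum (fun n => (D.integrable_step hA n j t).aestronglyMeasurable) h2]
  simp_rw [D.integral_step hA]
  have hsum : ∀ i, Summable fun n => P.real {ω | renewalTime τ (n + 1) ω ≤ t ∧ I n ω = i} :=
    fun i => ENNReal.summable_toReal (hfin i)
  rw [Summable.tsum_finsetSum fun i _ => (hsum i).mul_left _]
  refine Finset.sum_congr rfl fun i _ => ?_
  rw [tsum_mul_left, ← D.tsum_measure_renewal_color, ENNReal.tsum_toReal_eq fun n =>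
    measure_ne_top _ _]
  rfl

end IsDrivenBy

end PolyaWalk

theorem theorem2 {c : ℕ} {Ω Ω' : Type*} [MeasurableSpace Ω] [MeasurableSpace Ω']
    (P : Measure Ω) [IsProbabilityMeasure P] (P' : Measure Ω') [IsProbabilityMeasure P']
    (A : Ω' → Matrix (Fin c) (Fin c) ℝ) (hA : ∀ i j, Integrable (fun ω => A ω i j) P')
    (x₀ : Fin c → ℝ) (X : ℝ → Ω → Fin c → ℝ)
    (hX : PolyaWalk.IsContinuumPolyaWalk P P' A x₀ X) (t : ℝ) (ht : 0 ≤ t) :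
    Integrable (X t) P ∧
      ∫ ω, X t ω ∂P =
        (NormedSpace.exp (t • PolyaWalk.meanMatrix P' fun ω => (A ω).transpose)).mulVec x₀ := by
  obtain ⟨τ, I, M, D⟩ := hX
  have hint : ∀ s, 0 ≤ s → Integrable (X s) P := fun s hs =>
    Integrable.of_eval fun j => D.integrable_coord hA hs j
  refine ⟨hint t ht, ?_⟩
  obtain ⟨K, C, hK, hC, hbound⟩ := D.exists_tsum_sojournMean_le hA
  set Φ : Fin c → ℝ → ENNReal := fun j u => ∑' n, PolyaWalk.sojournMean P x₀ τ I M n j u with hΦ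
  have hΦm : ∀ j, Measurable (Φ j) := fun j =>
    Measurable.tsum fun n => D.measurable_sojournMean n j
  -- The series version of the mean is used because it is visibly measurable in `u`; it equals
  -- `E[X(u)]` for `u ≥ 0`.
  set f : ℝ → Fin c → ℝ := fun u j => (Φ j u).toReal with hf
  have hfX : ∀ s, 0 ≤ s → f s = ∫ ω, X s ω ∂P := by
    intro s hs
    ext j
    rw [eval_integral fun j => D.integrable_coord hA hs j, D.integral_coord hA hs]
  have hfbound : ∀ s, 0 ≤ s → s ≤ t → ‖f s‖ ≤ K * Real.exp (C * t) := by
    intro s hs hst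
    refine (pi_norm_le_iff_of_nonneg (by positivity)).2 fun j => ?_
    rw [Real.norm_of_nonneg ENNReal.toReal_nonneg]
    refine (ENNReal.toReal_le_of_le_ofReal (by positivity) (hbound s hs j)).trans ?_
    gcongr
  have hfm : Measurable f := measurable_pi_lambda _ fun j => (hΦm j).ennreal_toReal
  have hfint : IntegrableOn f (Set.Ioc 0 t) := by
    refine Measure.integrableOn_of_bounded (M := K * Real.exp (C * t)) (by simp)
      hfm.aestronglyMeasurable ?_
    exact (ae_restrict_iff' measurableSet_Ioc).2
      (Filter.Eventually.of_forall fun u hu => hfbound u hu.1.le hu.2)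
  rw [← hfX t ht]
  refine PolyaWalk.eq_exp_mulVec_of_integral_eq _ x₀ hfbound hfint (fun s hs hst => ?_) ht le_rfl
  ext j
  have hi := D.integral_coord_eq_add_integral hA hs j
  rw [D.integral_coord hA hs] at hi
  change (Φ j s).toReal = _
  rw [hi, Pi.add_apply]
  congr 1
  refine Finset.sum_congr rfl fun i _ => ?_
  congr 1
  have hfs : IntegrableOn f (Set.Ioc 0 s) := hfint.mono_set (Set.Ioc_subset_Ioc_right hst)
  rw [eval_integral fun i => hfs.eval i]
  refine (integral_toReal (hΦm i).aemeasurable ?_).symm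
  exact (ae_restrict_iff' measurableSet_Ioc).2 (Filter.Eventually.of_forall fun u hu =>
    (hbound u hu.1.le i).trans_lt ENNReal.ofReal_lt_top)
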